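/- Let $m\ge 2$ be an integer and let $n=2m-3$. We say that a configuration of $m$ distinct points in the Euclidean plane $\mathbb R^2$ realises an $n$-tuple $(\theta_1,\dots,\theta_n)\in[0,\pi]^n$ if for each $i$ there are three distinct points $A_i,B_i,C_i$ of the configuration such that the (unoriented) angle $\angle A_iB_iC_i$ equals $\theta_i$, and such that for $i\neq j$ the unordered pairs of rays $\{\overrightarrow{B_iA_i},\overrightarrow{B_iC_i}\}$ and $\{\overrightarrow{B_jA_j},\overrightarrow{B_jC_j}\}$ are different (so repeated angles are counted with multiplicity, and triples giving the same pair of rays count as one realisation). Let $S\subset[0,\pi]^n$ be the set of all $n$-tuples that are realised by some configuration of $m$ distinct points in the plane. Then $S$ has $n$-dimensional Lebesgue measure zero, and the Hausdorff dimension of $S$ is exactly $n-1$. (For $m=2$ the set $S$ is empty, and the Hausdorff dimension of the empty set is taken to be $0$.) -/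

import Mathlib

/-- The Euclidean plane. -/
abbrev Plane : Type := EuclideanSpace ℝ (Fin 2)

/-- The ray (closed half-line) with origin `B` passing through `A`. -/
def rayFrom (B A : Plane) : Set Plane :=
  {X | ∃ t : ℝ, 0 ≤ t ∧ X = B + t • (A - B)}

/-- The `m` points `p 0, …, p (m - 1)` of the plane realise the tuple of angles `θ`:
each entry `θ i` is the (unoriented) angle `A B C` for three distinct points `A`, `B`, `C` of the
configuration, and different entries of the tuple are realised by different unordered pairs of
rays `{BA, BC}`.  (A repeated angle has to be realised with multiplicity, and triples giving
rise to the same pair of rays count as the same realisation.) -/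
def Realises {m n : ℕ} (p : Fin m → Plane) (θ : Fin n → ℝ) : Prop :=
  ∃ a b c : Fin n → Fin m,
    (∀ i, a i ≠ b i ∧ c i ≠ b i ∧ a i ≠ c i) ∧
    (∀ i, EuclideanGeometry.angle (p (a i)) (p (b i)) (p (c i)) = θ i) ∧
    Function.Injective
      (fun i => s(rayFrom (p (b i)) (p (a i)), rayFrom (p (b i)) (p (c i))))

/-- The set of `n`-tuples in `[0, π]ⁿ` that are realised by some `m` distinct points in the
plane. -/
def realisableTuples (m n : ℕ) : Set (EuclideanSpace ℝ (Fin n)) :=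
  {θ | (∀ i, θ i ∈ Set.Icc 0 Real.pi) ∧
    ∃ p : Fin m → Plane, Function.Injective p ∧ Realises p (fun i => θ i)}

open Real Set Filter Topology MeasureTheory

/-! ### Upper bound on the dimension -/

/-! Write `m = k + 2`, so `n = 2k + 1` and the claimed dimension is `2k`. Angles are invariant under
similarities, so two points may be moved to `0` and `1`; the other `k` points contribute `2k` real
parameters. For each of the finitely many choices of triples, the angles are `C¹`, hence locally
Lipschitz, in these parameters, once coordinates equal to `0` or `π` are replaced by constants. So
`S` has dimension at most `2k < n`, and is null (`dimH_realisableTuples_le`).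

Conversely, erect `k` triangles on one common base. Their `2k` base angles can be prescribed freely
in an open set, and the apex angle of one triangle supplies the last entry. Projecting away that
entry is Lipschitz and its image contains the open set, so the dimension is at least `2k`
(`le_dimH_realisableTuples`). -/

theorem contDiffAt_angle_of_ne {W V : Type*} [NormedAddCommGroup W] [NormedSpace ℝ W]
    [NormedAddCommGroup V] [InnerProductSpace ℝ V] {f g : W → V} {w : W}
    (hf : ContDiffAt ℝ 1 f w) (hg : ContDiffAt ℝ 1 g w) (hf0 : f w ≠ 0) (hg0 : g w ≠ 0)
    (h0 : InnerProductGeometry.angle (f w) (g w) ≠ 0)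
    (hπ : InnerProductGeometry.angle (f w) (g w) ≠ π) :
    ContDiffAt ℝ 1 (fun w => InnerProductGeometry.angle (f w) (g w)) w := by
  unfold InnerProductGeometry.angle at *
  have h1 : inner ℝ (f w) (g w) / (‖f w‖ * ‖g w‖) ≠ -1 := fun h => hπ (by rw [h, arccos_neg_one])
  have h2 : inner ℝ (f w) (g w) / (‖f w‖ * ‖g w‖) ≠ 1 := fun h => h0 (by rw [h, arccos_one])
  have hq : ContDiffAt ℝ 1 (fun w => inner ℝ (f w) (g w) / (‖f w‖ * ‖g w‖)) w :=
    (hf.inner ℝ hg).div ((hf.norm ℝ hf0).mul (hg.norm ℝ hg0))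
      (mul_ne_zero (norm_ne_zero_iff.2 hf0) (norm_ne_zero_iff.2 hg0))
  exact ContDiffAt.comp (g := arccos) w (contDiffAt_arccos h1 h2) hq

/-- The configuration of `k + 2` points `0, 1, w 0, …, w (k - 1)` in the complex plane. -/
def normalisedConfig {k : ℕ} (w : Fin k → ℂ) : Fin (k + 2) → ℂ :=
  Fin.cons 0 (Fin.cons 1 w)

theorem contDiff_normalisedConfig {k : ℕ} (j : Fin (k + 2)) :
    ContDiff ℝ 1 (fun w : Fin k → ℂ => normalisedConfig w j) := by
  unfold normalisedConfig
  refine Fin.cases ?_ (fun j => ?_) j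
  · simpa using contDiff_const
  refine Fin.cases ?_ (fun j => ?_) j
  · simpa using contDiff_const
  · simpa using contDiff_apply ℝ ℂ j

theorem exists_normalisedConfig_eq {k : ℕ} {p : Fin (k + 2) → ℂ} (hp : p 1 ≠ p 0) :
    ∃ w : Fin k → ℂ, ∀ j, normalisedConfig w j = (p 1 - p 0)⁻¹ * (p j - p 0) := by
  refine ⟨fun j => (p 1 - p 0)⁻¹ * (p j.succ.succ - p 0), fun j => ?_⟩
  unfold normalisedConfig
  refine Fin.cases ?_ (fun j => ?_) j
  · simp
  refine Fin.cases ?_ (fun j => ?_) j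
  · simpa using (inv_mul_cancel₀ (sub_ne_zero.2 hp)).symm
  · simp

/-- The `i`-th angle `a i`, `b i`, `c i` of the normalised configuration `w`, replaced by the
constant `τ i` whenever that is given. -/
noncomputable def angleMap {k n : ℕ} (a b c : Fin n → Fin (k + 2)) (τ : Fin n → Option Bool)
    (w : Fin k → ℂ) : EuclideanSpace ℝ (Fin n) :=
  WithLp.toLp 2 fun i => match τ i with
    | none => InnerProductGeometry.angle (normalisedConfig w (a i) - normalisedConfig w (b i))
        (normalisedConfig w (c i) - normalisedConfig w (b i))
    | some false => 0
    | some true => π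

/-- The parameters at which every coordinate of `angleMap a b c τ` is manifestly smooth. -/
def regularParameters {k n : ℕ} (a b c : Fin n → Fin (k + 2)) (τ : Fin n → Option Bool) :
    Set (Fin k → ℂ) :=
  {w | ∀ i, τ i = none →
    normalisedConfig w (a i) - normalisedConfig w (b i) ≠ 0 ∧
    normalisedConfig w (c i) - normalisedConfig w (b i) ≠ 0 ∧
    InnerProductGeometry.angle (normalisedConfig w (a i) - normalisedConfig w (b i))
      (normalisedConfig w (c i) - normalisedConfig w (b i)) ≠ 0 ∧
    InnerProductGeometry.angle (normalisedConfig w (a i) - normalisedConfig w (b i))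
      (normalisedConfig w (c i) - normalisedConfig w (b i)) ≠ π}

theorem contDiffAt_angleMap {k n : ℕ} {a b c : Fin n → Fin (k + 2)} {τ : Fin n → Option Bool}
    {w : Fin k → ℂ} (hw : w ∈ regularParameters a b c τ) :
    ContDiffAt ℝ 1 (angleMap a b c τ) w := by
  rw [contDiffAt_euclidean]
  intro i
  unfold angleMap
  rcases h : τ i with _ | _ | _
  · obtain ⟨h1, h2, h3, h4⟩ := hw i h
    simp only [h]
    exact contDiffAt_angle_of_ne
      ((contDiff_normalisedConfig _).sub (contDiff_normalisedConfig _)).contDiffAt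
      ((contDiff_normalisedConfig _).sub (contDiff_normalisedConfig _)).contDiffAt h1 h2 h3 h4
  · simpa only [h] using contDiffAt_const
  · simpa only [h] using contDiffAt_const

/-- A map that is `C¹` at a point is Lipschitz near it, and locally Lipschitz maps do not raise
Hausdorff dimension. -/
theorem dimH_image_angleMap_le {k n : ℕ} (a b c : Fin n → Fin (k + 2)) (τ : Fin n → Option Bool) :
    dimH (angleMap a b c τ '' regularParameters a b c τ) ≤ (2 * k : ℕ) := by
  have hfin : Module.finrank ℝ (Fin k → ℂ) = 2 * k := by
    simp [Module.finrank_pi_fintype, Complex.finrank_real_complex, mul_comm]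
  calc dimH (angleMap a b c τ '' regularParameters a b c τ)
      ≤ dimH (regularParameters a b c τ) := by
        refine dimH_image_le_of_locally_lipschitzOn fun w hw => ?_
        obtain ⟨K, t, ht, hK⟩ := (contDiffAt_angleMap hw).exists_lipschitzOnWith
        exact ⟨K, t, mem_nhdsWithin_of_mem_nhds ht, hK⟩
    _ ≤ dimH (univ : Set (Fin k → ℂ)) := dimH_mono (subset_univ _)
    _ = (2 * k : ℕ) := by rw [Real.dimH_univ_eq_finrank, hfin]

theorem realisableTuples_subset_iUnion (k n : ℕ) :
    realisableTuples (k + 2) n ⊆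
      ⋃ d : (Fin n → Fin (k + 2)) × (Fin n → Fin (k + 2)) × (Fin n → Fin (k + 2)) ×
          (Fin n → Option Bool),
        angleMap d.1 d.2.1 d.2.2.1 d.2.2.2 '' regularParameters d.1 d.2.1 d.2.2.1 d.2.2.2 := by
  classical
  rintro θ ⟨-, p, hp, a, b, c, habc, hang, -⟩
  -- In `ℂ` the normalising similarity is a translation followed by multiplication by a nonzero
  -- number, which preserves angles.
  let φ : Plane ≃ₗᵢ[ℝ] ℂ := Complex.orthonormalBasisOneI.repr.symm
  have hne : φ (p 1) ≠ φ (p 0) := fun h => by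
    have := hp (φ.injective h)
    simp at this
  have hne' : (φ (p 1) - φ (p 0))⁻¹ ≠ 0 := inv_ne_zero (sub_ne_zero.2 hne)
  obtain ⟨w, hw⟩ := exists_normalisedConfig_eq (p := fun j => φ (p j)) hne
  have hsub : ∀ i j, normalisedConfig w i - normalisedConfig w j =
      (φ (p 1) - φ (p 0))⁻¹ * φ (p i - p j) := fun i j => by
    rw [hw, hw, ← mul_sub, map_sub]; ring
  have hangle : ∀ i, InnerProductGeometry.angle
      (normalisedConfig w (a i) - normalisedConfig w (b i))
      (normalisedConfig w (c i) - normalisedConfig w (b i)) = θ i := fun i => by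
    rw [hsub, hsub, Complex.angle_mul_left hne']
    exact (φ.toLinearIsometry.angle_map _ _).trans (hang i)
  have hsub0 : ∀ i j, i ≠ j → normalisedConfig w i - normalisedConfig w j ≠ 0 := fun i j hij => by
    rw [hsub]
    refine mul_ne_zero hne' fun h => hij (hp (sub_eq_zero.1 ?_))
    exact φ.injective (by rw [h, map_zero])
  -- `arccos` is not differentiable at `±1`, so `τ` freezes exactly the entries of `θ` equal to `0`
  -- or `π`.
  refine mem_iUnion.2 ⟨⟨a, b, c, fun i => if θ i = 0 then some false else
    if θ i = π then some true else none⟩, w, fun i hi => ?_, ?_⟩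
  · refine ⟨hsub0 _ _ (habc i).1, hsub0 _ _ (habc i).2.1, ?_, ?_⟩
    · rw [hangle]
      rintro h
      simp [h] at hi
    · rw [hangle]
      rintro h
      simp only [h, if_true] at hi
      split_ifs at hi
  · ext i
    simp only [angleMap]
    by_cases h0 : θ i = 0
    · simp [h0]
    · by_cases hπ : θ i = π
      · simp [hπ, Real.pi_ne_zero]
      · simp only [h0, hπ, if_false]
        exact hangle i

theorem dimH_realisableTuples_le (k n : ℕ) :
    dimH (realisableTuples (k + 2) n) ≤ (2 * k : ℕ) :=
  (dimH_mono (realisableTuples_subset_iUnion k n)).trans <| by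
    rw [dimH_iUnion]
    exact iSup_le fun d => dimH_image_angleMap_le _ _ _ _

theorem volume_eq_zero_of_dimH_lt_finrank {E : Type*} [NormedAddCommGroup E]
    [InnerProductSpace ℝ E] [FiniteDimensional ℝ E] [MeasurableSpace E] [BorelSpace E] {s : Set E}
    (hs : dimH s < Module.finrank ℝ E) : volume s = 0 := by
  refine measure_zero_of_dimH_lt (d := Module.finrank ℝ E) ?_ (by simpa using hs)
  rw [NNReal.coe_natCast]
  -- Hausdorff measure in the full dimension is a Haar measure, so its null sets are null for
  -- `volume`.
  exact Measure.absolutelyContinuous_isAddHaarMeasure _ _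

/-! ### Triangles over the unit base -/

/-- The end point of the unit base segment starting at the origin. -/
noncomputable def baseEnd : Plane := !₂[1, 0]

/-- The apex of the triangle over the unit base with base angles `α` and `β`. -/
noncomputable def apex (α β : ℝ) : Plane := (sin β / sin (α + β)) • !₂[cos α, sin α]

theorem baseEnd_ne_zero : baseEnd ≠ 0 := fun h => by
  have := congrArg (fun v : Plane => v 0) h
  simp [baseEnd] at this

/-- The law of sines gives both side lengths; seen from `baseEnd`, the apex lies in direction `π -
β`. -/
theorem apex_sub_baseEnd {α β : ℝ} (h : sin (α + β) ≠ 0) :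
    apex α β - baseEnd = (sin α / sin (α + β)) • !₂[-cos β, sin β] := by
  ext i
  fin_cases i
  · simp only [apex, baseEnd, PiLp.sub_apply, PiLp.smul_apply, smul_eq_mul, Fin.zero_eta,
      Matrix.cons_val_zero]
    field_simp
    rw [sin_add]
    ring
  · simp only [apex, baseEnd, PiLp.sub_apply, PiLp.smul_apply, smul_eq_mul, Fin.mk_one,
      Matrix.cons_val_one, Matrix.cons_val_zero]
    field_simp
    ring

theorem norm_cos_sin (α : ℝ) : ‖(!₂[cos α, sin α] : Plane)‖ = 1 := by
  simp [EuclideanSpace.norm_eq]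

theorem angle_baseEnd_smul {α r : ℝ} (hr : 0 < r) (h0 : 0 ≤ α) (hπ : α ≤ π) :
    InnerProductGeometry.angle baseEnd (r • !₂[cos α, sin α]) = α := by
  rw [InnerProductGeometry.angle_smul_right_of_pos _ _ hr, InnerProductGeometry.angle,
    norm_cos_sin]
  have h1 : ‖baseEnd‖ = 1 := by simp [baseEnd, EuclideanSpace.norm_eq]
  have h2 : inner ℝ baseEnd (!₂[cos α, sin α] : Plane) = cos α := by
    simp [baseEnd, PiLp.inner_apply]
  rw [h1, h2, mul_one, div_one, arccos_cos h0 hπ]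

section AcuteBaseAngles

variable {α β : ℝ} (hα : α ∈ Ioo (0 : ℝ) 1) (hβ : β ∈ Ioo (0 : ℝ) 1)

include hα hβ

/-- Base angles below `1` have sum below `2 < π`, so the triangle is nondegenerate. -/
theorem apex_coeff_pos : 0 < sin α ∧ 0 < sin β ∧ 0 < sin (α + β) := by
  have := pi_gt_three
  obtain ⟨h1, h2⟩ := hα
  obtain ⟨h3, h4⟩ := hβ
  exact ⟨sin_pos_of_pos_of_lt_pi h1 (by linarith), sin_pos_of_pos_of_lt_pi h3 (by linarith),
    sin_pos_of_pos_of_lt_pi (by linarith) (by linarith)⟩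

theorem apex_snd_pos : 0 < apex α β 1 := by
  obtain ⟨h1, h2, h3⟩ := apex_coeff_pos hα hβ
  simp only [apex, PiLp.smul_apply, smul_eq_mul, Matrix.cons_val_one,
      Matrix.cons_val_zero]
  positivity

theorem apex_ne_zero : apex α β ≠ 0 := fun h => by
  have := apex_snd_pos hα hβ
  simp [h] at this

theorem apex_ne_baseEnd : apex α β ≠ baseEnd := fun h => by
  have := apex_snd_pos hα hβ
  simp [h, baseEnd] at this

theorem angle_baseEnd_zero_apex : EuclideanGeometry.angle baseEnd 0 (apex α β) = α := by
  obtain ⟨h1, h2, h3⟩ := apex_coeff_pos hα hβ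
  have := pi_gt_three
  simp only [EuclideanGeometry.angle, vsub_eq_sub, sub_zero]
  exact angle_baseEnd_smul (div_pos h2 h3) hα.1.le (by linarith [hα.2])

theorem angle_zero_baseEnd_apex : EuclideanGeometry.angle 0 baseEnd (apex α β) = β := by
  obtain ⟨h1, h2, h3⟩ := apex_coeff_pos hα hβ
  have := pi_gt_three
  have h : (!₂[-cos β, sin β] : Plane) = !₂[cos (π - β), sin (π - β)] := by
    rw [cos_pi_sub, sin_pi_sub]
  simp only [EuclideanGeometry.angle, vsub_eq_sub, zero_sub]
  rw [apex_sub_baseEnd h3.ne', InnerProductGeometry.angle_neg_left, h,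
    angle_baseEnd_smul (div_pos h1 h3) (by linarith [hβ.2]) (by linarith [hβ.1])]
  ring

theorem angle_zero_apex_baseEnd :
    EuclideanGeometry.angle 0 (apex α β) baseEnd = π - α - β := by
  have h := EuclideanGeometry.angle_add_angle_add_angle_eq_pi (apex α β) baseEnd_ne_zero
  rw [angle_zero_baseEnd_apex hα hβ, EuclideanGeometry.angle_comm (apex α β) 0,
    angle_baseEnd_zero_apex hα hβ, EuclideanGeometry.angle_comm baseEnd] at h
  linarith

end AcuteBaseAngles

/-! ### Rays -/

theorem mem_rayFrom_self (B A : Plane) : A ∈ rayFrom B A := ⟨1, zero_le_one, by simp⟩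

theorem angle_eq_of_rayFrom_eq {A A' B : Plane} (hA : A ≠ B)
    (h : rayFrom B A = rayFrom B A') (Y : Plane) :
    EuclideanGeometry.angle Y B A = EuclideanGeometry.angle Y B A' := by
  obtain ⟨t, ht, hAt⟩ : A ∈ rayFrom B A' := h ▸ mem_rayFrom_self B A
  have ht0 : 0 < t := ht.lt_of_ne fun h0 => hA (by rw [hAt, ← h0]; simp)
  have : A - B = t • (A' - B) := by rw [hAt]; simp
  simp only [EuclideanGeometry.angle, vsub_eq_sub]
  rw [this, InnerProductGeometry.angle_smul_right_of_pos _ _ ht0]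

theorem rayFrom_subset_upper {A B : Plane} (hB : B 1 = 0) (hA : 0 ≤ A 1) :
    rayFrom B A ⊆ {X | 0 ≤ X 1} := by
  rintro X ⟨t, ht, rfl⟩
  simp only [mem_ofPred_eq, PiLp.add_apply, PiLp.smul_apply, PiLp.sub_apply, smul_eq_mul, hB]
  have := mul_nonneg ht hA
  linarith

theorem not_rayFrom_subset_upper {A B : Plane} (hB : 0 < B 1) (hA : A 1 = 0) :
    ¬ rayFrom B A ⊆ {X | 0 ≤ X 1} := fun h => by
  -- At `t = 2` the ray has crossed the axis to height `-B 1`.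
  have := h (⟨2, by norm_num, rfl⟩ : B + (2 : ℝ) • (A - B) ∈ rayFrom B A)
  simp only [mem_ofPred_eq, PiLp.add_apply, PiLp.smul_apply, PiLp.sub_apply, smul_eq_mul, hA] at this
  linarith

theorem rayFrom_zero_baseEnd_ne : rayFrom 0 baseEnd ≠ rayFrom baseEnd 0 := fun h => by
  obtain ⟨t, ht, hX⟩ : (0 : Plane) + (2 : ℝ) • (baseEnd - 0) ∈ rayFrom baseEnd 0 :=
    h ▸ ⟨2, by norm_num, rfl⟩
  have := congrArg (fun v : Plane => v 0) hX
  simp [baseEnd] at this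
  linarith

theorem zero_notMem_rayFrom_baseEnd {A : Plane} (hA : 0 < A 1) :
    (0 : Plane) ∉ rayFrom baseEnd A := by
  rintro ⟨t, ht, hX⟩
  have h1 := congrArg (fun v : Plane => v 1) hX
  simp [baseEnd, hA.ne'] at h1
  rw [h1] at hX
  exact baseEnd_ne_zero (by simpa using hX.symm)

theorem rayFrom_zero_ne_rayFrom_baseEnd {A A' : Plane} (hA : 0 < A 1) :
    rayFrom 0 A' ≠ rayFrom baseEnd A := fun h =>
  zero_notMem_rayFrom_baseEnd hA (h ▸ ⟨0, le_rfl, by simp⟩)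

/-! ### Lower bound on the dimension -/

/-- The end points of the base together with `k` apices over it, with base angles prescribed
by `x`. -/
noncomputable def fanConfig {k : ℕ} (x : Fin k ⊕ Fin k → ℝ) : Fin (k + 2) → Plane :=
  Fin.cons 0 (Fin.cons baseEnd fun j => apex (x (.inl j)) (x (.inr j)))

section Fan

variable {k : ℕ} (x : Fin k ⊕ Fin k → ℝ)

@[simp] theorem fanConfig_zero : fanConfig x 0 = 0 := rfl

@[simp] theorem fanConfig_one : fanConfig x 1 = baseEnd := rfl

@[simp] theorem fanConfig_succ_succ (j : Fin k) :
    fanConfig x j.succ.succ = apex (x (.inl j)) (x (.inr j)) := rfl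

/-- The first arm of the angles chosen in `fanConfig`. -/
def fanLeft : Option (Fin k ⊕ Fin k) → Fin (k + 2)
  | none => 0
  | some (.inl _) => 1
  | some (.inr _) => 0

/-- The vertices of the angles chosen in `fanConfig`: both base angles of every triangle and the
apex angle of the triangle with index `l`. -/
def fanVertex (l : Fin k) : Option (Fin k ⊕ Fin k) → Fin (k + 2)
  | none => l.succ.succ
  | some (.inl _) => 0
  | some (.inr _) => 1

/-- The second arm of the angles chosen in `fanConfig`. -/
def fanRight : Option (Fin k ⊕ Fin k) → Fin (k + 2)
  | none => 1
  | some (.inl j) => j.succ.succ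
  | some (.inr j) => j.succ.succ

/-- The angles chosen in `fanConfig`. -/
noncomputable def fanAngle (l : Fin k) : Option (Fin k ⊕ Fin k) → ℝ
  | none => π - x (.inl l) - x (.inr l)
  | some s => x s

theorem fan_distinct (l : Fin k) (s : Option (Fin k ⊕ Fin k)) :
    fanLeft s ≠ fanVertex l s ∧ fanRight s ≠ fanVertex l s ∧ fanLeft s ≠ fanRight s := by
  rcases s with _ | j | j <;> simp [fanLeft, fanVertex, fanRight, Fin.ext_iff]

variable {x}

theorem angle_fanConfig (hx : ∀ s, x s ∈ Ioo (0 : ℝ) 1) (l : Fin k)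
    (s : Option (Fin k ⊕ Fin k)) :
    EuclideanGeometry.angle (fanConfig x (fanLeft s)) (fanConfig x (fanVertex l s))
      (fanConfig x (fanRight s)) = fanAngle x l s := by
  rcases s with _ | j | j
  · exact angle_zero_apex_baseEnd (hx _) (hx _)
  · exact angle_baseEnd_zero_apex (hx _) (hx _)
  · exact angle_zero_baseEnd_apex (hx _) (hx _)

theorem fanConfig_injective (hx : ∀ s, x s ∈ Ioo (0 : ℝ) 1) (hinj : Function.Injective x) :
    Function.Injective (fanConfig x) := by
  unfold fanConfig
  refine Fin.cons_injective_iff.2 ⟨?_, Fin.cons_injective_iff.2 ⟨?_, fun i j hij => ?_⟩⟩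
  · rintro ⟨j, hj⟩
    refine Fin.cases (fun h => ?_) (fun j h => ?_) j hj
    · exact baseEnd_ne_zero h
    · exact apex_ne_zero (hx _) (hx _) h
  · rintro ⟨j, hj⟩
    exact apex_ne_baseEnd (hx _) (hx _) hj
  · have h := congrArg (EuclideanGeometry.angle baseEnd 0) hij
    simp only [angle_baseEnd_zero_apex (hx _) (hx _)] at h
    exact Sum.inl_injective (hinj h)

/-- Rays from one base end are told apart by their angle with the base, as `x` is injective and
positive. A ray from `baseEnd` to an apex misses `0`, unlike any ray from `0`. The ray from apex `l`
to `0` leaves the upper half-plane, while all rays used at the base ends stay in it. -/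
theorem fan_rays_injective (hx : ∀ s, x s ∈ Ioo (0 : ℝ) 1) (hinj : Function.Injective x)
    (l : Fin k) :
    Function.Injective fun s : Option (Fin k ⊕ Fin k) =>
      s(rayFrom (fanConfig x (fanVertex l s)) (fanConfig x (fanLeft s)),
        rayFrom (fanConfig x (fanVertex l s)) (fanConfig x (fanRight s))) := by
  have hpos : ∀ j, 0 < apex (x (.inl j)) (x (.inr j)) 1 := fun j => apex_snd_pos (hx _) (hx _)
  have he : baseEnd 1 = 0 := by simp [baseEnd]
  have h1 : ∀ j, rayFrom 0 (apex (x (.inl j)) (x (.inr j))) ≠ rayFrom 0 baseEnd := fun j h => by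
    have := angle_eq_of_rayFrom_eq (apex_ne_zero (hx _) (hx _)) h baseEnd
    rw [angle_baseEnd_zero_apex (hx _) (hx _),
      EuclideanGeometry.angle_self_of_ne baseEnd_ne_zero] at this
    exact (hx _).1.ne' this
  have h2 : ∀ i j, rayFrom 0 (apex (x (.inl i)) (x (.inr i))) =
      rayFrom 0 (apex (x (.inl j)) (x (.inr j))) → i = j := fun i j h => by
    have := angle_eq_of_rayFrom_eq (apex_ne_zero (hx _) (hx _)) h baseEnd
    rw [angle_baseEnd_zero_apex (hx _) (hx _), angle_baseEnd_zero_apex (hx _) (hx _)] at this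
    exact Sum.inl_injective (hinj this)
  have h3 : ∀ j, rayFrom baseEnd (apex (x (.inl j)) (x (.inr j))) ≠ rayFrom baseEnd 0 :=
    fun j h => by
    have := angle_eq_of_rayFrom_eq (apex_ne_baseEnd (hx _) (hx _)) h 0
    rw [angle_zero_baseEnd_apex (hx _) (hx _),
      EuclideanGeometry.angle_self_of_ne baseEnd_ne_zero.symm] at this
    exact (hx _).1.ne' this
  have h4 : ∀ i j, rayFrom baseEnd (apex (x (.inl i)) (x (.inr i))) =
      rayFrom baseEnd (apex (x (.inl j)) (x (.inr j))) → i = j := fun i j h => by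
    have := angle_eq_of_rayFrom_eq (apex_ne_baseEnd (hx _) (hx _)) h 0
    rw [angle_zero_baseEnd_apex (hx _) (hx _), angle_zero_baseEnd_apex (hx _) (hx _)] at this
    exact Sum.inr_injective (hinj this)
  have h5 := rayFrom_zero_baseEnd_ne
  have h6 : ∀ (A : Plane) j, rayFrom 0 A ≠ rayFrom baseEnd (apex (x (.inl j)) (x (.inr j))) :=
    fun A j => rayFrom_zero_ne_rayFrom_baseEnd (hpos j)
  have hdown : ¬ rayFrom (apex (x (.inl l)) (x (.inr l))) 0 ⊆ {X | 0 ≤ X 1} :=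
    not_rayFrom_subset_upper (hpos l) rfl
  have h7 : ∀ B A : Plane, B 1 = 0 → 0 ≤ A 1 →
      rayFrom B A ≠ rayFrom (apex (x (.inl l)) (x (.inr l))) 0 := fun B A hB hA h =>
    hdown (h ▸ rayFrom_subset_upper hB hA)
  have z : (0 : Plane) 1 = 0 := rfl
  have h8 := h7 0 baseEnd z he.ge
  have h9 := h7 baseEnd 0 he z.ge
  have h10 := fun j => h7 0 _ z (hpos j).le
  have h11 := fun j => h7 baseEnd _ he (hpos j).le
  rintro (_ | i | i) (_ | j | j) h <;>
    simp only [fanLeft, fanVertex, fanRight, fanConfig_zero, fanConfig_one, fanConfig_succ_succ,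
      Sym2.eq_iff] at h
  · rfl
  · rcases h with h | h
    · exact (h8 h.1.symm).elim
    · exact (h10 _ h.1.symm).elim
  · rcases h with h | h
    · exact (h9 h.1.symm).elim
    · exact (h11 _ h.1.symm).elim
  · rcases h with h | h
    · exact (h8 h.1).elim
    · exact (h10 _ h.2).elim
  · rcases h with h | h
    · rw [h2 _ _ h.2]
    · exact (h1 _ h.2).elim
  · rcases h with h | h
    · exact (h5 h.1).elim
    · exact (h6 _ _ h.1).elim
  · rcases h with h | h
    · exact (h9 h.1).elim
    · exact (h11 _ h.2).elim
  · rcases h with h | h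
    · exact (h5 h.1.symm).elim
    · exact (h6 _ _ h.2.symm).elim
  · rcases h with h | h
    · rw [h4 _ _ h.2]
    · exact (h3 _ h.2).elim

theorem fanAngle_mem_realisableTuples {n : ℕ} (σ : Fin n ≃ Option (Fin k ⊕ Fin k))
    (hx : ∀ s, x s ∈ Ioo (0 : ℝ) 1) (hinj : Function.Injective x) (l : Fin k) :
    WithLp.toLp 2 (fun i => fanAngle x l (σ i)) ∈ realisableTuples (k + 2) n := by
  refine ⟨fun i => ?_, fanConfig x, fanConfig_injective hx hinj, fun i => fanLeft (σ i),
    fun i => fanVertex l (σ i), fun i => fanRight (σ i), fun i => fan_distinct l (σ i),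
    fun i => angle_fanConfig hx l (σ i), (fan_rays_injective hx hinj l).comp σ.injective⟩
  change fanAngle x l (σ i) ∈ _
  rw [← angle_fanConfig hx]
  exact ⟨EuclideanGeometry.angle_nonneg _ _ _, EuclideanGeometry.angle_le_pi _ _ _⟩

end Fan

theorem isOpen_setOf_injective_Ioo {ι : Type*} [Finite ι] :
    IsOpen {x : ι → ℝ | (∀ s, x s ∈ Ioo (0 : ℝ) 1) ∧ Function.Injective x} := by
  have : {x : ι → ℝ | (∀ s, x s ∈ Ioo (0 : ℝ) 1) ∧ Function.Injective x} =
      (⋂ s, {x | x s ∈ Ioo (0 : ℝ) 1}) ∩ ⋂ s, ⋂ t, ⋂ _ : s ≠ t, {x | x s ≠ x t} := by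
    ext x
    simp only [mem_ofPred_eq, mem_inter_iff, mem_iInter, Function.Injective]
    refine and_congr_right fun _ => forall₂_congr fun s t => ?_
    rw [← not_imp_not]
  rw [this]
  refine (isOpen_iInter_of_finite fun s => isOpen_Ioo.preimage (continuous_apply s)).inter
    (isOpen_iInter_of_finite fun s => isOpen_iInter_of_finite fun t =>
      isOpen_iInter_of_finite fun _ => ?_)
  exact isOpen_ne_fun (continuous_apply s) (continuous_apply t)

theorem exists_injective_Ioo (ι : Type*) [Finite ι] :
    ∃ x : ι → ℝ, (∀ s, x s ∈ Ioo (0 : ℝ) 1) ∧ Function.Injective x := by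
  obtain ⟨N, ⟨e⟩⟩ := Finite.exists_equiv_fin ι
  refine ⟨fun s => 1 / ((e s : ℕ) + 2 : ℝ), fun s => ⟨by positivity, ?_⟩, fun s t h => ?_⟩
  · rw [div_lt_one (by positivity)]
    have : (0 : ℝ) ≤ (e s : ℕ) := by positivity
    linarith
  · simp only [one_div, inv_inj, add_left_inj, Nat.cast_inj] at h
    exact e.injective (Fin.ext h)

theorem le_dimH_realisableTuples {k : ℕ} (l : Fin k) :
    ((2 * k : ℕ) : ENNReal) ≤ dimH (realisableTuples (k + 2) (2 * k + 1)) := by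
  let σ : Fin (2 * k + 1) ≃ Option (Fin k ⊕ Fin k) := Fintype.equivOfCardEq (by simp; ring)
  let π' : EuclideanSpace ℝ (Fin (2 * k + 1)) →L[ℝ] (Fin k ⊕ Fin k → ℝ) :=
    ContinuousLinearMap.pi fun s => EuclideanSpace.proj (σ.symm (some s))
  set U : Set (Fin k ⊕ Fin k → ℝ) := {x | (∀ s, x s ∈ Ioo (0 : ℝ) 1) ∧ Function.Injective x}
    with hU
  have hUdim : dimH U = (2 * k : ℕ) := by
    have hne : U.Nonempty := exists_injective_Ioo _
    rw [Real.dimH_of_nonempty_interior (by rwa [isOpen_setOf_injective_Ioo.interior_eq])]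
    simp [two_mul]
  -- `π'` forgets the apex angle and keeps the base angles, so it returns `x` itself.
  have hsub : U ⊆ π' '' realisableTuples (k + 2) (2 * k + 1) := fun x hx => by
    refine ⟨_, fanAngle_mem_realisableTuples σ hx.1 hx.2 l, ?_⟩
    ext s
    simp [π', fanAngle]
  rw [← hUdim]
  exact (dimH_mono hsub).trans (π'.lipschitz.dimH_image_le _)

theorem corollary12 (m n : ℕ) (hm : 2 ≤ m) (hn : n = 2 * m - 3) :
    MeasureTheory.volume (realisableTuples m n) = 0 ∧
      dimH (realisableTuples m n) = ((n - 1 : ℕ) : ENNReal) := by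
  obtain ⟨k, rfl⟩ := Nat.exists_eq_add_of_le' hm
  obtain rfl : n = 2 * k + 1 := by omega
  have hle := dimH_realisableTuples_le k (2 * k + 1)
  refine ⟨volume_eq_zero_of_dimH_lt_finrank (hle.trans_lt ?_), le_antisymm hle ?_⟩
  · rw [finrank_euclideanSpace_fin]
    exact_mod_cast Nat.lt_succ_self _
  -- For `k = 0` there is no apex `l` to choose, but the lower bound is just `0`.
  · rcases k.eq_zero_or_pos with rfl | hk
    · simp
    · exact le_dimH_realisableTuples ⟨0, hk⟩
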